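/- Let $D=(V,A)$ be a finite directed graph, loops and multiple arcs being allowed, let $R$ be a commutative ring, and let $\mathbf{x}=(x_1,x_2,\ldots)$ be indeterminates. For $y,z\in R$ put $$B_D(\mathbf{x};y,z)=\sum_{f:V\to\{1,2,\ldots\}}\Big(\prod_{v\in V}x_{f(v)}\Big)\,y^{\#\{(u,v)\in A:\ f(u)<f(v)\}}\,z^{\#\{(u,v)\in A:\ f(u)>f(v)\}},$$ where arcs are counted with multiplicity. This is an element of the $R$-module $\mathrm{QSym}_R(\mathbf{x})$ of quasisymmetric functions, that is, of the power series $g$ over $R$ in $\mathbf{x}$ of bounded degree such that $x_{i_1}^{\delta_1}\cdots x_{i_k}^{\delta_k}$ and $x_{j_1}^{\delta_1}\cdots x_{j_k}^{\delta_k}$ have the same coefficient in $g$ for all positive integers $\delta_1,\ldots,\delta_k$, $i_1<\cdots<i_k$ and $j_1<\cdots<j_k$. This module has the basis of the $$M_{(\delta_1,\ldots,\delta_k)}=\sum_{i_1<\cdots<i_k}x_{i_1}^{\delta_1}\cdots x_{i_k}^{\delta_k},$$ where $(\delta_1,\ldots,\delta_k)$ runs over the compositions of all $n\ge 0$, and the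 basis of the $$F_{n,S}=\sum_{\substack{i_1\le\cdots\le i_n\\ i_s<i_{s+1}\text{ if }s\in S}}x_{i_1}\cdots x_{i_n},$$ where $n\ge 0$ and $S\subseteq[n-1]=\{1,\ldots,n-1\}$. Let $\omega$ and $\rho$ be the $R$-linear maps on $\mathrm{QSym}_R(\mathbf{x})$ such that $\omega(F_{n,S})=F_{n,[n-1]\setminus S}$ and $\rho(M_{(\delta_1,\ldots,\delta_k)})=M_{(\delta_k,\ldots,\delta_1)}$. If $D$ is acyclic (has no directed cycle), then for every invertible $y\in R$ $$\omega\big(B_D(\mathbf{x};y,1)\big)=\rho\big(y^{|A|}B_D(\mathbf{x};1/y,1)\big).$$ If the graph underlying $D$, which has one edge $\{u,v\}$ for each arc $(u,v)$, is a forest (it has no cycle; loops and pairs of parallel edges are cycles), then for all $y,z\in R$ such that $y+z-1$ is invertible $$\omega\big(B_D(\mathbf{x};y,z)\big)=(y+z-1)^{|A|}\,B_D\Big(\mathbf{x};\frac{y}{y+z-1},\frac{z}{y+z-1}\Big).$$ In particular both identities hold for indeterminates $y,z$, with $R$ the fraction field of $\mathbb{Z}[y,z]$. -/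

import Mathlib

namespace QuasiB

open Finsupp

/-- The formal power series `∑ i, c i • x ^ (e i)` in the variables `x_1, x_2, …`, for a family
of exponents `e` in which each exponent occurs finitely often. -/
noncomputable def formalSum {ι R : Type*} [CommRing R] (c : ι → R) (e : ι → (ℕ+ →₀ ℕ)) :
    MvPowerSeries ℕ+ R :=
  fun m => ∑ᶠ i ∈ e ⁻¹' {m}, c i

theorem coeff_formalSum {ι R : Type*} [CommRing R] (c : ι → R) (e : ι → (ℕ+ →₀ ℕ)) (m : ℕ+ →₀ ℕ) :
    MvPowerSeries.coeff m (formalSum c e) = ∑ᶠ i ∈ e ⁻¹' {m}, c i := rfl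

theorem coeff_formalSum_of_injective {ι R : Type*} [CommRing R] (e : ι → (ℕ+ →₀ ℕ))
    (he : Function.Injective e) (m : ℕ+ →₀ ℕ) [Decidable (∃ i, e i = m)] :
    MvPowerSeries.coeff m (formalSum (fun _ => (1 : R)) e) = if ∃ i, e i = m then 1 else 0 := by
  rw [coeff_formalSum]
  split_ifs with h
  · obtain ⟨i, rfl⟩ := h
    rw [← Set.image_singleton, Set.preimage_image_eq _ he, finsum_mem_singleton]
  · have : e ⁻¹' {m} = ∅ := by
      ext i; simpa using fun hi => h ⟨i, hi⟩
    rw [this, finsum_mem_empty]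

section words
variable {n : ℕ}

/-- The exponent vector of the monomial `x_{w_1} ⋯ x_{w_n}`. -/
noncomputable def wordExp (w : Fin n → ℕ+) : ℕ+ →₀ ℕ := ∑ a, single (w a) 1

theorem degree_wordExp (w : Fin n → ℕ+) : (wordExp w).degree = n := by
  simp [wordExp, map_sum]

theorem toMultiset_wordExp (w : Fin n → ℕ+) :
    Finsupp.toMultiset (wordExp w) = (List.ofFn w : Multiset ℕ+) := by
  rw [wordExp, map_sum]
  simp only [toMultiset_single, one_smul]
  rw [← List.sum_ofFn]
  induction n with
  | zero => simp
  | succ n ih => rw [List.ofFn_succ, List.ofFn_succ, List.sum_cons, ih (fun a => w a.succ)]; rfl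

theorem wordExp_inj {w w' : Fin n → ℕ+} (hw : Monotone w) (hw' : Monotone w')
    (h : wordExp w = wordExp w') : w = w' := by
  have h1 := congrArg Finsupp.toMultiset h
  rw [toMultiset_wordExp, toMultiset_wordExp, Multiset.coe_eq_coe] at h1
  exact List.ofFn_injective (h1.eq_of_pairwise' hw.sortedLE_ofFn.pairwise hw'.sortedLE_ofFn.pairwise)

theorem exists_word (m : ℕ+ →₀ ℕ) : ∃ w : Fin m.degree → ℕ+, Monotone w ∧ wordExp w = m := by
  set l := (Finsupp.toMultiset m).sort (· ≤ ·) with hl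
  have hlen : l.length = m.degree := by
    rw [hl, Multiset.length_sort, Finsupp.card_toMultiset]; rfl
  have hs : l.SortedLE := (Multiset.pairwise_sort _ _).sortedLE
  refine ⟨fun a => l.get (a.cast hlen.symm), ?_, ?_⟩
  · exact hs.monotone_get.comp (Fin.cast_strictMono _).monotone
  · apply Function.LeftInverse.injective Finsupp.toMultiset_toFinsupp
    rw [toMultiset_wordExp]
    conv_rhs => rw [← Multiset.sort_eq (Finsupp.toMultiset m) (· ≤ ·)]
    rw [← hl]
    congr 1
    generalize m.degree = d at hlen
    subst hlen
    exact List.ofFn_get l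

/-- The set of `s` such that the letters in positions `s` and `s + 1` differ. -/
def ascSet (w : Fin n → ℕ+) : Finset (Fin (n - 1)) :=
  {s | w ⟨s, by omega⟩ < w ⟨s + 1, by omega⟩}

/-- The letters of a monomial, in increasing order. -/
noncomputable def word (m : ℕ+ →₀ ℕ) : Fin m.degree → ℕ+ := (exists_word m).choose

theorem word_mono (m : ℕ+ →₀ ℕ) : Monotone (word m) := (exists_word m).choose_spec.1

theorem wordExp_word (m : ℕ+ →₀ ℕ) : wordExp (word m) = m := (exists_word m).choose_spec.2

/-- The degree of a monomial and the set of positions where its increasing word jumps. -/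
noncomputable def code (m : ℕ+ →₀ ℕ) : Σ n : ℕ, Finset (Fin (n - 1)) :=
  ⟨m.degree, ascSet (word m)⟩

theorem code_wordExp {w : Fin n → ℕ+} (hw : Monotone w) : code (wordExp w) = ⟨n, ascSet w⟩ := by
  have key : ∀ (m : ℕ+ →₀ ℕ) (d : ℕ) (w : Fin d → ℕ+), Monotone w → wordExp w = m →
      (⟨m.degree, ascSet (word m)⟩ : Σ n : ℕ, Finset (Fin (n - 1))) = ⟨d, ascSet w⟩ := by
    intro m d w hw h
    have hd : d = m.degree := by rw [← h, degree_wordExp]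
    subst hd
    rw [wordExp_inj (word_mono m) hw ((wordExp_word m).trans h.symm)]
  exact key _ _ w hw rfl

theorem code_eq_iff (m : ℕ+ →₀ ℕ) (S : Finset (Fin (n - 1))) :
    code m = ⟨n, S⟩ ↔ ∃ w : Fin n → ℕ+, Monotone w ∧ wordExp w = m ∧ ascSet w = S := by
  constructor
  · intro h
    obtain ⟨h1, h2⟩ := Sigma.mk.inj h
    subst h1
    exact ⟨word m, word_mono m, wordExp_word m, eq_of_heq h2⟩
  · rintro ⟨w, hw, rfl, rfl⟩
    exact code_wordExp hw

/-- The subset of `[n - 1]` of partial sums of a composition of `n`. -/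
def compSet : Composition n ≃ Finset (Fin (n - 1)) :=
  (compositionEquiv n).trans (compositionAsSetEquiv n)

theorem index_mono (δ : Composition n) : Monotone δ.index := by
  intro a b hab
  by_contra! h
  have h1 := δ.sizeUpTo_index_le a
  have h2 := δ.lt_sizeUpTo_index_succ b
  have h3 : δ.sizeUpTo (δ.index b).succ ≤ δ.sizeUpTo (δ.index a) :=
    δ.monotone_sizeUpTo (by simpa using h)
  have : (a : ℕ) ≤ b := hab
  omega

theorem mem_compSet (δ : Composition n) (s : Fin (n - 1)) :
    s ∈ compSet δ ↔ δ.index ⟨s, by omega⟩ < δ.index ⟨s + 1, by omega⟩ := by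
  have h0 : s ∈ compSet δ ↔ ∃ i : Fin (δ.length + 1), δ.sizeUpTo i = s + 1 := by
    simp only [compSet, compositionAsSetEquiv, compositionEquiv, Composition.boundaries,
      Composition.boundary, Equiv.trans_apply, Equiv.coe_fn_mk, Set.mem_toFinset,
      Set.mem_ofPred_eq, Composition.toCompositionAsSet_boundaries, Finset.mem_map,
      Finset.mem_univ, true_and, RelEmbedding.coe_toEmbedding, OrderEmbedding.coe_ofStrictMono,
      Fin.mk.injEq, add_comm 1]
  rw [h0]
  have h1 := δ.sizeUpTo_index_le ⟨s, by omega⟩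
  have h2 := δ.lt_sizeUpTo_index_succ ⟨s, by omega⟩
  have h3 := δ.sizeUpTo_index_le ⟨s + 1, by omega⟩
  have h4 := δ.lt_sizeUpTo_index_succ ⟨s + 1, by omega⟩
  set a := δ.index ⟨s, by omega⟩
  set b := δ.index ⟨s + 1, by omega⟩
  simp only [Fin.val_succ] at *
  constructor
  · rintro ⟨i, hi⟩
    by_contra! h
    have h5 : (i : ℕ) < b + 1 := by
      by_contra! h'
      have := δ.monotone_sizeUpTo h'
      omega
    have h6 : (a : ℕ) < i := by
      by_contra! h'
      have := δ.monotone_sizeUpTo h'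
      omega
    have : (b : ℕ) ≤ a := h
    omega
  · intro h
    refine ⟨b.castSucc, ?_⟩
    have : δ.sizeUpTo (a + 1) ≤ δ.sizeUpTo b := δ.monotone_sizeUpTo h
    simp only [Fin.val_castSucc]
    omega

theorem sum_blocks (δ : Composition n) (i : Fin δ.length → ℕ+) :
    ∑ t, single (i t) (δ.blocksFun t) = wordExp (i ∘ δ.index) := by
  rw [wordExp, ← δ.blocksFinEquiv.sum_comp, Fintype.sum_sigma]
  refine Finset.sum_congr rfl fun t _ => ?_
  have : ∀ y : Fin (δ.blocksFun t), single ((i ∘ δ.index) (δ.blocksFinEquiv ⟨t, y⟩)) 1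
      = single (i t) 1 := by
    intro y
    simp [Composition.blocksFinEquiv, Composition.index_embedding]
  rw [Finset.sum_congr rfl fun y _ => this y]
  simp

theorem ascSet_comp_index (δ : Composition n) (i : Fin δ.length ↪o ℕ+) :
    ascSet (i ∘ δ.index) = compSet δ := by
  ext s
  simp [ascSet, mem_compSet]

theorem mono_comp_index (δ : Composition n) (i : Fin δ.length ↪o ℕ+) :
    Monotone (i ∘ δ.index) := i.monotone.comp (index_mono δ)

theorem code_sum_blocks (δ : Composition n) (i : Fin δ.length ↪o ℕ+) :
    code (∑ t, single (i t) (δ.blocksFun t)) = ⟨n, compSet δ⟩ := by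
  rw [sum_blocks, code_wordExp (mono_comp_index δ i), ascSet_comp_index]

theorem index_surj (δ : Composition n) : Function.Surjective δ.index := fun t =>
  ⟨δ.embedding t ⟨0, δ.one_le_blocksFun t⟩,
    δ.index_embedding _ _⟩

theorem sum_blocks_injective (δ : Composition n) : Function.Injective
    fun i : Fin δ.length ↪o ℕ+ => ∑ t, single (i t) (δ.blocksFun t) := by
  intro i j h
  simp only [sum_blocks] at h
  have := wordExp_inj (mono_comp_index δ i) (mono_comp_index δ j) h
  exact DFunLike.coe_injective ((index_surj δ).injective_comp_right this)

theorem exists_of_ascSet_eq (δ : Composition n) (w : Fin n → ℕ+) (hw : Monotone w)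
    (h : ascSet w = compSet δ) : ∃ i : Fin δ.length ↪o ℕ+, i ∘ δ.index = w := by
  have hstep : ∀ s : Fin (n - 1), (w ⟨s, by omega⟩ < w ⟨s + 1, by omega⟩ ↔
      δ.index ⟨s, by omega⟩ < δ.index ⟨s + 1, by omega⟩) := by
    intro s
    rw [← mem_compSet, ← h]; simp [ascSet]
  have hlt : ∀ (a b : ℕ) (hab : a ≤ b) (hb : b < n),
      w ⟨a, by omega⟩ < w ⟨b, hb⟩ ↔ δ.index ⟨a, by omega⟩ < δ.index ⟨b, hb⟩ := by
    intro a b hab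
    induction b, hab using Nat.le_induction with
    | base => intro hb; simp
    | succ b hab ih =>
      intro hb
      have h1 := ih (by omega)
      have h2 := hstep ⟨b, by omega⟩
      have h3 : w ⟨a, by omega⟩ ≤ w ⟨b, by omega⟩ := hw hab
      have h4 : w ⟨b, by omega⟩ ≤ w ⟨b + 1, by omega⟩ := hw (by simp)
      have h5 : δ.index ⟨a, by omega⟩ ≤ δ.index ⟨b, by omega⟩ := index_mono δ hab
      have h6 : δ.index ⟨b, by omega⟩ ≤ δ.index ⟨b + 1, by omega⟩ := index_mono δ (by simp)
      simp only at h2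
      constructor
      · intro h7
        by_cases h8 : w ⟨a, by omega⟩ < w ⟨b, by omega⟩
        · exact (h1.1 h8).trans_le h6
        · exact h5.trans_lt (h2.1 (lt_of_le_of_lt (not_lt.1 h8) h7))
      · intro h7
        by_cases h8 : δ.index ⟨a, by omega⟩ < δ.index ⟨b, by omega⟩
        · exact (h1.2 h8).trans_le h4
        · exact h3.trans_lt (h2.2 (lt_of_le_of_lt (not_lt.1 h8) h7))
  have hlt' : ∀ a b : Fin n, w a < w b ↔ δ.index a < δ.index b := by
    intro a b
    rcases le_total a b with hab | hab
    · exact hlt a b hab b.2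
    · exact iff_of_false (not_lt.2 (hw hab)) (not_lt.2 (index_mono δ hab))
  let r := Function.surjInv (index_surj δ)
  have hr : ∀ t, δ.index (r t) = t := Function.surjInv_eq (index_surj δ)
  refine ⟨OrderEmbedding.ofStrictMono (fun t => w (r t)) ?_, ?_⟩
  · intro s t hst
    rw [hlt', hr, hr]; exact hst
  · funext a
    have h1 := hlt' a (r (δ.index a))
    have h2 := hlt' (r (δ.index a)) a
    rw [hr] at h1 h2
    simp only [lt_self_iff_false, iff_false, not_lt] at h1 h2
    exact le_antisymm h1 h2

theorem code_eq_compSet_iff (δ : Composition n) (m : ℕ+ →₀ ℕ) :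
    (∃ i : Fin δ.length ↪o ℕ+, ∑ t, single (i t) (δ.blocksFun t) = m) ↔
      code m = ⟨n, compSet δ⟩ := by
  constructor
  · rintro ⟨i, rfl⟩
    exact code_sum_blocks δ i
  · rw [code_eq_iff]
    rintro ⟨w, hw, rfl, h⟩
    obtain ⟨i, rfl⟩ := exists_of_ascSet_eq δ w hw h
    exact ⟨i, sum_blocks δ i⟩

end words

section qsym
variable (R : Type*) [CommRing R]

/-- The module of quasisymmetric functions in `x_1, x_2, …` over `R`: the power series of bounded
degree in which `x_{i_1}^{δ_1} ⋯ x_{i_k}^{δ_k}` and `x_{j_1}^{δ_1} ⋯ x_{j_k}^{δ_k}` have the same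
coefficient whenever `i_1 < ⋯ < i_k` and `j_1 < ⋯ < j_k`. -/
def QSym : Submodule R (MvPowerSeries ℕ+ R) where
  carrier := {f | (∃ N : ℕ, ∀ m : ℕ+ →₀ ℕ, MvPowerSeries.coeff m f ≠ 0 → m.degree ≤ N) ∧
    ∀ (k : ℕ) (δ : Fin k → ℕ) (i j : Fin k ↪o ℕ+), (∀ t, 0 < δ t) →
      MvPowerSeries.coeff (∑ t, single (i t) (δ t)) f =
        MvPowerSeries.coeff (∑ t, single (j t) (δ t)) f}
  add_mem' := by
    rintro f g ⟨⟨N, hN⟩, hf⟩ ⟨⟨N', hN'⟩, hg⟩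
    refine ⟨⟨max N N', fun m hm => ?_⟩, fun k δ i j hδ => ?_⟩
    · by_contra! h
      have h1 : MvPowerSeries.coeff m f = 0 := by
        by_contra h'; exact absurd (hN m h') (by omega)
      have h2 : MvPowerSeries.coeff m g = 0 := by
        by_contra h'; exact absurd (hN' m h') (by omega)
      exact hm (by rw [map_add, h1, h2, add_zero])
    · rw [map_add, map_add, hf k δ i j hδ, hg k δ i j hδ]
  zero_mem' := ⟨⟨0, fun m hm => absurd (map_zero _) hm⟩, fun k δ i j _ => by simp⟩
  smul_mem' := by
    rintro c f ⟨⟨N, hN⟩, hf⟩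
    refine ⟨⟨N, fun m hm => hN m fun h => hm ?_⟩, fun k δ i j hδ => ?_⟩
    · rw [map_smul, h, smul_zero]
    · rw [map_smul, map_smul, hf k δ i j hδ]

variable {R}

/-- The coefficient of a monomial in a quasisymmetric function only depends on its exponents
read in increasing order of the variables. -/
theorem coeff_eq_of_code_eq {f : MvPowerSeries ℕ+ R} (hf : f ∈ QSym R) {m m' : ℕ+ →₀ ℕ}
    (h : code m = code m') : MvPowerSeries.coeff m f = MvPowerSeries.coeff m' f := by
  obtain ⟨n, S, hS⟩ : ∃ n, ∃ S : Finset (Fin (n - 1)), code m = ⟨n, S⟩ := ⟨_, _, rfl⟩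
  have h1 : code m = ⟨n, compSet (compSet.symm S)⟩ := by rw [hS, Equiv.apply_symm_apply]
  have h2 : code m' = ⟨n, compSet (compSet.symm S)⟩ := h ▸ h1
  obtain ⟨i, rfl⟩ := (code_eq_compSet_iff _ _).2 h1
  obtain ⟨j, rfl⟩ := (code_eq_compSet_iff _ _).2 h2
  exact hf.2 _ _ i j fun t => Composition.one_le_blocksFun _ t

theorem exists_code_eq (p : Σ n : ℕ, Finset (Fin (n - 1))) : ∃ m, code m = p := by
  obtain ⟨n, S⟩ := p
  let δ : Composition n := compSet.symm S
  let i : Fin δ.length ↪o ℕ+ := OrderEmbedding.ofStrictMono (fun t => t.1.succPNat)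
    (fun s t h => Nat.succPNat_lt_succPNat.2 h)
  exact ⟨_, (code_sum_blocks δ i).trans (by simp [δ])⟩

theorem mem_QSym_of_code (Φ : (Σ n : ℕ, Finset (Fin (n - 1))) →₀ R) :
    (fun m => Φ (code m) : MvPowerSeries ℕ+ R) ∈ QSym R := by
  refine ⟨⟨Φ.support.sup Sigma.fst, fun m hm => ?_⟩, fun k δ i j hδ => ?_⟩
  · exact Finset.le_sup (f := Sigma.fst) (Finsupp.mem_support_iff.2 hm)
  · let c : Composition (List.ofFn δ).sum :=
      ⟨List.ofFn δ, fun {i} hi => by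
        obtain ⟨t, rfl⟩ := (List.mem_ofFn' δ i).1 hi
        exact hδ t, rfl⟩
    have hlen : c.length = k := List.length_ofFn
    have h : ∀ i : Fin k ↪o ℕ+, code (∑ t, single (i t) (δ t)) = ⟨_, compSet c⟩ := by
      intro i
      have h1 := code_sum_blocks c ((Fin.castOrderIso hlen).toOrderEmbedding.trans i)
      rw [← h1]
      congr 1
      rw [← (finCongr hlen).sum_comp]
      refine Finset.sum_congr rfl fun t _ => ?_
      congr 1
      simp only [Composition.blocksFun, c, List.get_ofFn]
      rfl
    change Φ (code _) = Φ (code _)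
    rw [h i, h j]

/-- Quasisymmetric functions in coordinates. -/
noncomputable def coord : QSym R ≃ₗ[R] ((Σ n : ℕ, Finset (Fin (n - 1))) →₀ R) where
  toFun f := Finsupp.ofSupportFinite
    (fun p => MvPowerSeries.coeff (exists_code_eq p).choose f.1) (by
      obtain ⟨N, hN⟩ := f.2.1
      refine ((Finset.range (N + 1)).sigma fun _ => Finset.univ).finite_toSet.subset ?_
      intro p hp
      have h1 := hN _ hp
      have h2 := congrArg Sigma.fst (exists_code_eq p).choose_spec
      have h3 : p.1 ≤ N := by rw [← h2]; exact h1
      simp only [Finset.coe_sigma, Set.mem_sigma_iff, Finset.coe_range, Set.mem_Iio,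
        Finset.coe_univ, Set.mem_univ, and_true]
      omega)
  invFun Φ := ⟨fun m => Φ (code m), mem_QSym_of_code Φ⟩
  map_add' f g := by ext p; simp [Finsupp.ofSupportFinite_coe]
  map_smul' c f := by ext p; simp [Finsupp.ofSupportFinite_coe]
  left_inv f := by
    apply Subtype.ext
    ext m
    exact coeff_eq_of_code_eq f.2 (exists_code_eq (code m)).choose_spec
  right_inv Φ := by
    ext p
    change Φ (code _) = _
    rw [(exists_code_eq p).choose_spec]

theorem coeff_coord_symm (Φ : (Σ n : ℕ, Finset (Fin (n - 1))) →₀ R) (m : ℕ+ →₀ ℕ) :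
    MvPowerSeries.coeff m (coord.symm Φ : QSym R).1 = Φ (code m) := rfl

variable (R)

/-- `M_δ = ∑ x_{i_1}^{δ_1} ⋯ x_{i_k}^{δ_k}` over `i_1 < ⋯ < i_k`. -/
noncomputable def monomialSeries {n : ℕ} (δ : Composition n) : MvPowerSeries ℕ+ R :=
  formalSum (fun _ => 1) fun i : Fin δ.length ↪o ℕ+ => ∑ t, single (i t) (δ.blocksFun t)

/-- `F_{n,S} = ∑ x_{i_1} ⋯ x_{i_n}` over `i_1 ≤ ⋯ ≤ i_n` with `i_s < i_{s+1}` for `s ∈ S`. The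
element `s` of `Fin (n - 1)` stands for the element `s + 1` of `{1, …, n - 1}`, and positions in
the word `i` are counted from `0`. -/
noncomputable def fundamentalSeries (n : ℕ) (S : Finset (Fin (n - 1))) : MvPowerSeries ℕ+ R :=
  formalSum (fun _ => 1)
    fun i : {i : Fin n → ℕ+ // Monotone i ∧ ∀ s ∈ S, i ⟨s, by omega⟩ < i ⟨s + 1, by omega⟩} =>
      ∑ a, single (i.1 a) 1

theorem monomialSeries_eq {n : ℕ} (δ : Composition n) :
    monomialSeries R δ = (coord.symm (single ⟨n, compSet δ⟩ 1) : QSym R).1 := by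
  classical
  ext m
  rw [monomialSeries, coeff_formalSum_of_injective _ (sum_blocks_injective δ), coeff_coord_symm,
    Finsupp.single_apply]
  simp only [code_eq_compSet_iff, eq_comm (a := code m)]

theorem fundamentalSeries_eq (n : ℕ) (S : Finset (Fin (n - 1))) :
    fundamentalSeries R n S =
      (coord.symm (∑ T with S ⊆ T, single ⟨n, T⟩ 1) : QSym R).1 := by
  classical
  ext m
  rw [fundamentalSeries, coeff_formalSum_of_injective, coeff_coord_symm]
  · rw [Finsupp.finsetSum_apply]
    simp only [Finsupp.single_apply]
    split_ifs with h
    · obtain ⟨⟨w, hw, hS⟩, rfl⟩ := h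
      change 1 = ∑ x with S ⊆ x, if _ = code (wordExp w) then 1 else 0
      rw [code_wordExp hw, Finset.sum_eq_single_of_mem (ascSet w)]
      · simp
      · simp only [Finset.mem_filter, Finset.mem_univ, true_and]
        intro s hs
        simpa [ascSet] using hS s hs
      · intro T _ hT
        rw [if_neg]
        simpa using hT
    · symm
      refine Finset.sum_eq_zero fun T hT => if_neg fun hm => h ?_
      obtain ⟨w, hw, rfl, rfl⟩ := (code_eq_iff m T).1 hm.symm
      refine ⟨⟨w, hw, fun s hs => ?_⟩, rfl⟩
      have := (Finset.mem_filter.1 hT).2 hs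
      simpa [ascSet] using this
  · intro i j h
    exact Subtype.ext (wordExp_inj i.2.1 j.2.1 h)

/-- The monomial quasisymmetric function `M_δ`. -/
noncomputable def M {n : ℕ} (δ : Composition n) : QSym R :=
  ⟨monomialSeries R δ, by rw [monomialSeries_eq]; exact Subtype.property _⟩

/-- The fundamental quasisymmetric function `F_{n,S}`. -/
noncomputable def F (n : ℕ) (S : Finset (Fin (n - 1))) : QSym R :=
  ⟨fundamentalSeries R n S, by rw [fundamentalSeries_eq]; exact Subtype.property _⟩

theorem M_eq {n : ℕ} (δ : Composition n) : M R δ = coord.symm (single ⟨n, compSet δ⟩ 1) :=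
  Subtype.ext (monomialSeries_eq R δ)

theorem F_eq (n : ℕ) (S : Finset (Fin (n - 1))) :
    F R n S = coord.symm (∑ T with S ⊆ T, single ⟨n, T⟩ 1) :=
  Subtype.ext (fundamentalSeries_eq R n S)

/-- The basis `(M_δ)` of the module of quasisymmetric functions. -/
noncomputable def basisM : Module.Basis (Σ n : ℕ, Composition n) R (QSym R) :=
  Module.Basis.ofRepr (coord.trans
    (Finsupp.domLCongr (Equiv.sigmaCongrRight fun _ => compSet.symm)))

theorem basisM_apply (p : Σ n : ℕ, Composition n) : basisM R p = M R p.2 := by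
  rw [M_eq, basisM, Module.Basis.coe_ofRepr]
  simp
  rfl

theorem sum_neg_one_pow {α : Type*} [Fintype α] [DecidableEq α] (S U : Finset α) (h : S ⊆ U) :
    (∑ T with S ⊆ T ∧ T ⊆ U, (-1 : R) ^ (T \ S).card) = if S = U then 1 else 0 := by
  have h1 := congrArg (Int.cast : ℤ → R) (Finset.sum_powerset_neg_one_pow_card (x := U \ S))
  push_cast at h1
  have h2 : (U \ S = ∅) ↔ S = U := by
    rw [Finset.sdiff_eq_empty_iff_subset]
    exact ⟨fun h' => h.antisymm h', fun h' => h'.ge⟩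
  simp only [h2] at h1
  rw [← h1]
  refine Finset.sum_bij' (fun T _ => T \ S) (fun T _ => T ∪ S) ?_ ?_ ?_ ?_ ?_
  · intro T hT
    simp only [Finset.mem_filter, Finset.mem_univ, true_and] at hT
    exact Finset.mem_powerset.2 (Finset.sdiff_subset_sdiff hT.2 le_rfl)
  · intro T hT
    simp only [Finset.mem_filter, Finset.mem_univ, true_and]
    exact ⟨Finset.subset_union_right,
      Finset.union_subset ((Finset.mem_powerset.1 hT).trans Finset.sdiff_subset) h⟩
  · intro T hT
    simp only [Finset.mem_filter, Finset.mem_univ, true_and] at hT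
    exact Finset.sdiff_union_of_subset hT.1
  · intro T hT
    have hT' := Finset.mem_powerset.1 hT
    ext x
    have := @hT' x
    simp only [Finset.mem_sdiff, Finset.mem_union] at this ⊢
    tauto
  · intro T _; rfl

theorem sum_neg_one_pow' {α : Type*} [Fintype α] [DecidableEq α] (S U : Finset α) (h : S ⊆ U) :
    (∑ T with S ⊆ T ∧ T ⊆ U, (-1 : R) ^ (U \ T).card) = if S = U then 1 else 0 := by
  rw [← sum_neg_one_pow R S U h]
  refine Finset.sum_bij' (fun T _ => S ∪ (U \ T)) (fun T _ => S ∪ (U \ T)) ?_ ?_ ?_ ?_ ?_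
  · intro T hT
    simp only [Finset.mem_filter, Finset.mem_univ, true_and] at hT ⊢
    exact ⟨Finset.subset_union_left, Finset.union_subset h Finset.sdiff_subset⟩
  · intro T hT
    simp only [Finset.mem_filter, Finset.mem_univ, true_and] at hT ⊢
    exact ⟨Finset.subset_union_left, Finset.union_subset h Finset.sdiff_subset⟩
  · intro T hT
    simp only [Finset.mem_filter, Finset.mem_univ, true_and] at hT
    ext x
    have h1 := @hT.1 x
    have h2 := @hT.2 x
    simp only [Finset.mem_sdiff, Finset.mem_union]
    tauto
  · intro T hT
    simp only [Finset.mem_filter, Finset.mem_univ, true_and] at hT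
    ext x
    have h1 := @hT.1 x
    have h2 := @hT.2 x
    simp only [Finset.mem_sdiff, Finset.mem_union]
    tauto
  · intro T hT
    simp only [Finset.mem_filter, Finset.mem_univ, true_and] at hT
    congr 2
    ext x
    have h1 := @hT.1 x
    simp only [Finset.mem_sdiff, Finset.mem_union]
    tauto

/-- The change of coordinates `e_S ↦ ∑_{T ⊇ S} e_T`. -/
noncomputable def zetaEquiv : ((Σ n : ℕ, Finset (Fin (n - 1))) →₀ R) ≃ₗ[R]
    ((Σ n : ℕ, Finset (Fin (n - 1))) →₀ R) :=
  LinearEquiv.ofLinearMap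
    (Finsupp.linearCombination R fun p => ∑ T with p.2 ⊆ T, single ⟨p.1, T⟩ 1)
    (Finsupp.linearCombination R fun p =>
      ∑ T with p.2 ⊆ T, single ⟨p.1, T⟩ ((-1) ^ (T \ p.2).card))
    (by
      refine Finsupp.lhom_ext' fun ⟨n, S⟩ => LinearMap.ext_ring ?_
      simp only [LinearMap.comp_apply, Finsupp.lsingle_apply, Finsupp.linearCombination_single,
        one_smul, map_sum, LinearMap.id_apply, Finset.smul_sum, Finsupp.smul_single, smul_eq_mul,
        mul_one]
      rw [Finset.sum_comm' (t' := {U | S ⊆ U}) (s' := fun U => {T | S ⊆ T ∧ T ⊆ U})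
        (by
          intro T U
          simp only [Finset.mem_filter, Finset.mem_univ, true_and]
          exact ⟨fun h => ⟨h, h.1.trans h.2⟩, fun h => h.1⟩)]
      simp only [← Finsupp.single_finsetSum]
      rw [Finset.sum_eq_single_of_mem S (by simp)]
      · rw [sum_neg_one_pow R S S le_rfl, if_pos rfl]
      · intro U hU hne
        rw [sum_neg_one_pow R S U (by simpa using hU), if_neg hne.symm, Finsupp.single_zero])
    (by
      refine Finsupp.lhom_ext' fun ⟨n, S⟩ => LinearMap.ext_ring ?_
      simp only [LinearMap.comp_apply, Finsupp.lsingle_apply, Finsupp.linearCombination_single,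
        one_smul, map_sum, LinearMap.id_apply]
      rw [Finset.sum_comm' (t' := {U | S ⊆ U}) (s' := fun U => {T | S ⊆ T ∧ T ⊆ U})
        (by
          intro T U
          simp only [Finset.mem_filter, Finset.mem_univ, true_and]
          exact ⟨fun h => ⟨h, h.1.trans h.2⟩, fun h => h.1⟩)]
      simp only [← Finsupp.single_finsetSum]
      rw [Finset.sum_eq_single_of_mem S (by simp)]
      · rw [sum_neg_one_pow' R S S le_rfl, if_pos rfl]
      · intro U hU hne
        rw [sum_neg_one_pow' R S U (by simpa using hU), if_neg hne.symm, Finsupp.single_zero])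

/-- The basis `(F_{n,S})` of the module of quasisymmetric functions. -/
noncomputable def basisF : Module.Basis (Σ n : ℕ, Finset (Fin (n - 1))) R (QSym R) :=
  Module.Basis.ofRepr (coord.trans (zetaEquiv R).symm)

theorem basisF_apply (p : Σ n : ℕ, Finset (Fin (n - 1))) : basisF R p = F R p.1 p.2 := by
  rw [F_eq, basisF, Module.Basis.coe_ofRepr]
  simp [zetaEquiv]

/-- The linear map with `F_{n,S} ↦ F_{n,[n-1] ∖ S}`. -/
noncomputable def omega : QSym R →ₗ[R] QSym R :=
  (basisF R).constr R fun p => F R p.1 p.2ᶜ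

/-- The linear map with `M_{(δ_1,…,δ_k)} ↦ M_{(δ_k,…,δ_1)}`. -/
noncomputable def rho : QSym R →ₗ[R] QSym R :=
  (basisM R).constr R fun p => M R p.2.reverse

theorem omega_F (n : ℕ) (S : Finset (Fin (n - 1))) : omega R (F R n S) = F R n Sᶜ := by
  have := (basisF R).constr_basis R (fun p => F R p.1 p.2ᶜ) ⟨n, S⟩
  rwa [basisF_apply] at this

theorem rho_M {n : ℕ} (δ : Composition n) : rho R (M R δ) = M R δ.reverse := by
  have := (basisM R).constr_basis R (fun p => M R p.2.reverse) ⟨n, δ⟩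
  rwa [basisM_apply] at this

end qsym

/-- A directed graph with vertex set `V` and arc set `A`; loops and multiple arcs are allowed. -/
structure MultiDigraph (V A : Type*) where
  /-- The origin of an arc. -/
  src : A → V
  /-- The target of an arc. -/
  tgt : A → V

namespace MultiDigraph
variable {V A : Type*} (D : MultiDigraph V A)

/-- No directed cycle, that is, no closed directed walk of positive length. -/
def IsAcyclic : Prop :=
  ∀ v, ¬ Relation.TransGen (fun u v => ∃ a, D.src a = u ∧ D.tgt a = v) v v

/-- The underlying simple graph, which forgets directions, loops and multiplicities. -/
def toSimpleGraph : SimpleGraph V :=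
  SimpleGraph.fromRel fun u v => ∃ a, D.src a = u ∧ D.tgt a = v

/-- The underlying multigraph, with one edge `{u, v}` for each arc `(u, v)`, has no cycle: it has
no loop (a cycle of length one), no two edges with the same endpoints (a cycle of length two), and
no cycle of length at least three. -/
def IsForest : Prop :=
  (∀ a, D.src a ≠ D.tgt a) ∧ Function.Injective (fun a => s(D.src a, D.tgt a)) ∧
    D.toSimpleGraph.IsAcyclic

variable [Fintype A]

/-- The number of arcs `(u, v)` with `f u < f v`. -/
def asc {P : Type*} [LinearOrder P] (f : V → P) : ℕ :=
  (Finset.univ.filter fun a => f (D.src a) < f (D.tgt a)).card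

/-- The number of arcs `(u, v)` with `f v < f u`. -/
def des {P : Type*} [LinearOrder P] (f : V → P) : ℕ :=
  (Finset.univ.filter fun a => f (D.tgt a) < f (D.src a)).card

variable [Fintype V] {R : Type*} [CommRing R]

/-- `∑_f (∏_v x_{f v}) y ^ asc f * z ^ des f` over all colorings `f` of the vertices by positive
integers. -/
noncomputable def quasiBSeries (y z : R) : MvPowerSeries ℕ+ R :=
  formalSum (fun f : V → ℕ+ => y ^ D.asc f * z ^ D.des f) fun f => ∑ v, single (f v) 1

theorem finite_colorings (m : ℕ+ →₀ ℕ) :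
    ((fun f : V → ℕ+ => ∑ v, single (f v) 1) ⁻¹' {m}).Finite := by
  refine (Set.Finite.pi' fun _ : V => m.support.finite_toSet).subset ?_
  rintro f rfl v
  simp only [Finset.mem_coe, Finsupp.mem_support_iff, Finsupp.finsetSum_apply]
  have h : 1 ≤ ∑ u, (single (f u) 1 : ℕ+ →₀ ℕ) (f v) := by
    refine le_trans ?_ (Finset.single_le_sum (fun _ _ => Nat.zero_le _) (Finset.mem_univ v))
    simp
  omega

theorem coeff_quasiBSeries (y z : R) {k : ℕ} (δ : Fin k → ℕ) (i : Fin k ↪o ℕ+) :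
    MvPowerSeries.coeff (∑ t, single (i t) (δ t)) (D.quasiBSeries y z) =
      ∑ᶠ g ∈ {g : V → Fin k | ∑ v, single (g v) 1 = ∑ t, single t (δ t)},
        y ^ D.asc g * z ^ D.des g := by
  rw [quasiBSeries, coeff_formalSum]
  have hmap : ∀ g : V → Fin k, (∑ v, single (i (g v)) 1 : ℕ+ →₀ ℕ) =
      Finsupp.mapDomain i (∑ v, single (g v) 1) := by
    intro g; simp [Finsupp.mapDomain_finsetSum, Finsupp.mapDomain_single]
  have hmap' : (∑ t, single (i t) (δ t) : ℕ+ →₀ ℕ) =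
      Finsupp.mapDomain i (∑ t, single t (δ t)) := by
    simp [Finsupp.mapDomain_finsetSum, Finsupp.mapDomain_single]
  symm
  refine finsum_mem_eq_of_bijOn (fun g => i ∘ g) ⟨?_, ?_, ?_⟩ ?_
  · intro g hg
    change ∑ v, single (i (g v)) 1 = _
    rw [hmap, hmap']
    exact congrArg _ hg
  · intro g _ g' _ h
    exact i.injective.comp_left h
  · intro f hf
    have hf' : ∑ v, single (f v) 1 = ∑ t, single (i t) (δ t) := hf
    have hr : ∀ v, ∃ t, i t = f v := by
      intro v
      by_contra! hv
      have h := DFunLike.congr_fun hf' (f v)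
      simp only [Finsupp.finsetSum_apply] at h
      rw [Finset.sum_eq_zero (s := Finset.univ) (f := fun t => (single (i t) (δ t)) (f v))
        (fun t _ => Finsupp.single_eq_of_ne (hv t).symm)] at h
      have := Finset.sum_eq_zero_iff.1 h v (Finset.mem_univ v)
      simp at this
    choose g hg using hr
    have hfg : i ∘ g = f := funext hg
    refine ⟨g, ?_, hfg⟩
    subst hfg
    refine Finsupp.mapDomain_injective i.injective ?_
    rw [← hmap, ← hmap']
    exact hf'
  · intro g _
    simp [asc, des]

theorem quasiBSeries_mem (y z : R) : D.quasiBSeries y z ∈ QSym R := by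
  refine ⟨⟨Fintype.card V, fun m hm => ?_⟩, fun k δ i j _ => ?_⟩
  · rw [quasiBSeries, coeff_formalSum] at hm
    obtain ⟨f, hf, -⟩ := exists_ne_zero_of_finsum_mem_ne_zero hm
    have hf' : ∑ v, single (f v) 1 = m := hf
    simp [← hf', map_sum]
  · rw [coeff_quasiBSeries, coeff_quasiBSeries]

/-- The quasisymmetric `B`-polynomial `B_D(x; y, z)`. -/
noncomputable def quasiB (y z : R) : QSym R := ⟨D.quasiBSeries y z, D.quasiBSeries_mem y z⟩

end MultiDigraph
end QuasiB

/-!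
Let `r_s` be the relation on the vertices left when each arc is kept (`s a = 1`), reversed
(`s a = -1`) or deleted (`s a = 0`). Writing the factor of each arc in `y ^ asc f * z ^ des f` as
`1 + (y - 1) [f u < f v] + (z - 1) [f v < f u]` and expanding the product over the arcs presents
`B_D` as a linear combination, over all `s`, of the generating functions of the colorings that
strictly increase along `r_s`. If `r_s` is acyclic, these colorings and the weakly increasing ones
are `(P, ω)`-partitions for two opposite labellings, so by the fundamental lemma both generating
functions are sums of fundamental quasisymmetric functions over the same linear extensions, with
complementary descent sets: `ω` sends the strict one to the weak one. Only acyclic `r_s` have a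
nonzero coefficient, when `D` is acyclic and `z = 1`, or when `D` is a forest.

Recombining the weakly increasing colorings turns each factor into `y`, `z` or `y + z - 1` according
to whether the arc is an ascent, a descent or a tie. As every arc is one of the three, the powers of
`y + z - 1` can be moved to a global factor, and `ρ` exchanges ascents and descents.
-/

namespace QuasiB

open Finsupp

section Colorings
variable {V W R : Type*} [Fintype V] [Fintype W] [CommRing R]

/-- The generating function `∑_f c f * ∏_v x_{f v}` of a weight `c` on the colorings of `V` by
positive integers. -/
noncomputable def coloringSeries : ((V → ℕ+) → R) →ₗ[R] MvPowerSeries ℕ+ R where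
  toFun c := formalSum c fun f => ∑ v, single (f v) 1
  map_add' c d := by
    ext m
    exact finsum_mem_add_distrib (MultiDigraph.finite_colorings m)
  map_smul' r c := by
    ext m
    exact (smul_finsum_mem (r := r) (f := c) (MultiDigraph.finite_colorings m)).symm

theorem coloringSeries_comp_equiv (e : W ≃ V) (c : (W → ℕ+) → R) :
    coloringSeries (fun f : V → ℕ+ => c (f ∘ e)) = coloringSeries c := by
  have fiber_comp (f : V → ℕ+) : ∑ w, single (f (e w)) 1 = ∑ v, single (f v) 1 :=
    e.sum_comp fun v => single (f v) 1
  ext m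
  refine finsum_mem_eq_of_bijOn (· ∘ e) ⟨fun f hf => (fiber_comp f).trans hf,
    e.surjective.injective_comp_right.injOn, fun f hf => ⟨f ∘ e.symm, ?_, ?_⟩⟩ fun _ _ => rfl
  · refine (fiber_comp (f ∘ e.symm)).symm.trans ?_
    simpa using hf
  · simp [Function.comp_assoc]

theorem formalSum_subtype {ι : Type*} (p : ι → Prop) (c : ι → R) (e : ι → ℕ+ →₀ ℕ) :
    formalSum (fun i : {i // p i} => c i) (fun i => e i) = formalSum ({i | p i}.indicator c) e := by
  ext m
  have bijOn_val : Set.BijOn Subtype.val ((fun i : {i // p i} => e i) ⁻¹' {m})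
      (e ⁻¹' {m} ∩ {i | p i}) :=
    ⟨fun i hi => ⟨hi, i.2⟩, Subtype.val_injective.injOn, fun i hi => ⟨⟨i, hi.2⟩, hi.1, rfl⟩⟩
  rw [coeff_formalSum, coeff_formalSum, finsum_mem_eq_of_bijOn _ bijOn_val fun _ _ => rfl,
    finsum_mem_def, finsum_mem_def, Set.indicator_indicator]

end Colorings

section Sorting
variable {V L : Type*} [LinearOrder L]

theorem existsUnique_strictMono_comp_equiv [Fintype V] {k : V → L} (hk : k.Injective) :
    ∃! π : Fin (Fintype.card V) ≃ V, StrictMono (k ∘ π) := by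
  let _ : LinearOrder V := LinearOrder.lift' k hk
  have strictMono_k : StrictMono k := fun _ _ h => h
  let toIso (π : Fin (Fintype.card V) ≃ V) (hπ : StrictMono (k ∘ π)) :
      Fin (Fintype.card V) ≃o V :=
    StrictMono.orderIsoOfSurjective π (fun _ _ h => hπ h) π.surjective
  refine ⟨(monoEquivOfFin V rfl).toEquiv, strictMono_k.comp (monoEquivOfFin V rfl).strictMono,
    fun π hπ => Equiv.ext fun i => ?_⟩
  exact DFunLike.congr_fun (Subsingleton.elim (toIso π hπ) (monoEquivOfFin V rfl)) i

/-- The descents of a finite sequence; as in `fundamentalSeries`, the element `s` of `Fin (n - 1)`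
stands for the pair of consecutive positions `s` and `s + 1` counted from `0`. -/
def descSet {n : ℕ} (p : Fin n → L) : Finset (Fin (n - 1)) :=
  {s | p ⟨s + 1, by omega⟩ < p ⟨s, by omega⟩}

theorem descSet_toDual {n : ℕ} {p : Fin n → L} (hp : p.Injective) :
    descSet (OrderDual.toDual ∘ p) = (descSet p)ᶜ := by
  ext s
  have consecutive_ne : p ⟨s, by omega⟩ ≠ p ⟨s + 1, by omega⟩ := hp.ne (by simp)
  simp [descSet, consecutive_ne.le_iff_lt]

theorem strictMono_toLex_iff {n : ℕ} {α : Type*} [LinearOrder α] {p : Fin n → L}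
    (hp : p.Injective) (w : Fin n → α) :
    StrictMono (fun i => toLex (w i, p i)) ↔
      Monotone w ∧ ∀ s ∈ descSet p, w ⟨s, by omega⟩ < w ⟨s + 1, by omega⟩ := by
  cases n with
  | zero => simp [Subsingleton.strictMono, Subsingleton.monotone]
  | succ n =>
    have step (s : Fin n) : toLex (w s.castSucc, p s.castSucc) < toLex (w s.succ, p s.succ) ↔
        w s.castSucc ≤ w s.succ ∧ (p s.succ < p s.castSucc → w s.castSucc < w s.succ) := by
      have consecutive_ne : p s.castSucc ≠ p s.succ := hp.ne (by simp [Fin.ext_iff])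
      rw [Prod.Lex.toLex_lt_toLex]
      grind
    simp only [Fin.strictMono_iff_lt_succ, step, forall_and, Fin.monotone_iff_le_succ]
    refine and_congr_right fun _ => forall_congr' fun s => ?_
    simp only [descSet, Finset.mem_filter, Finset.mem_univ, true_and]
    rfl

theorem exists_linearOrder_of_acyclic {r : V → V → Prop}
    (hr : ∀ v, ¬ Relation.TransGen r v v) :
    ∃ _ : LinearOrder V, ∀ u v, r u v → u < v := by
  have : IsStrictOrder V (Relation.TransGen r) :=
    { irrefl := hr, trans := fun _ _ _ => Relation.TransGen.trans }
  let _ : PartialOrder V := partialOrderOfSO (Relation.TransGen r)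
  refine ⟨LinearOrder.lift' toLinearExtension Function.injective_id, fun u v huv => ?_⟩
  have lt : u < v := Relation.TransGen.single huv
  exact toLinearExtension.monotone.strictMono_of_injective Function.injective_id lt

end Sorting

section Partitions
variable {V L : Type*} [Fintype V] [LinearOrder L] (R : Type*) [CommRing R]

open Classical in
/-- The linear extensions of a relation `r` on `V`: the enumerations of `V` in which `u` precedes
`v` whenever `r u v`. -/
noncomputable def linExts (r : V → V → Prop) : Finset (Fin (Fintype.card V) ≃ V) :=
  {π | ∀ u v, r u v → π.symm u < π.symm v}

theorem fundamentalSeries_descSet {n : ℕ} {p : Fin n → L} (hp : p.Injective) :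
    fundamentalSeries R n (descSet p) =
      coloringSeries ({w | StrictMono fun i => toLex (w i, p i)}.indicator 1) := by
  simp only [strictMono_toLex_iff hp]
  exact formalSum_subtype _ (fun _ => 1) wordExp

theorem fundamentalSeries_descSet_comp {ℓ : V → L} (hℓ : ℓ.Injective)
    (π : Fin (Fintype.card V) ≃ V) :
    fundamentalSeries R (Fintype.card V) (descSet (ℓ ∘ π)) =
      coloringSeries ({f | StrictMono fun i => toLex (f (π i), ℓ (π i))}.indicator 1) := by
  rw [fundamentalSeries_descSet R (hℓ.comp π.injective), ← coloringSeries_comp_equiv π]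
  rfl

/-- Stanley's `(P, ω)`-partitions, for an arbitrary relation `r` in place of the order of `P` and
for the labelling `ℓ` in place of `ω`: the colorings which weakly increase along `r`, and strictly
so along the pairs at which `ℓ` does not increase. -/
def partitions (r : V → V → Prop) (ℓ : V → L) : Set (V → ℕ+) :=
  {f | ∀ u v, r u v → toLex (f u, ℓ u) < toLex (f v, ℓ v)}

/-- The fundamental lemma on `(P, ω)`-partitions: a coloring `f` is classified by the enumeration
of `V` which sorts it, ties being broken by `ℓ`. -/
theorem coloringSeries_partitions (r : V → V → Prop) {ℓ : V → L} (hℓ : ℓ.Injective) :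
    coloringSeries ((partitions r ℓ).indicator (1 : (V → ℕ+) → R)) =
      ∑ π ∈ linExts r, fundamentalSeries R (Fintype.card V) (descSet (ℓ ∘ π)) := by
  classical
  simp only [fundamentalSeries_descSet_comp R hℓ, ← map_sum]
  congr 1
  funext f
  let key (v : V) : ℕ+ ×ₗ L := toLex (f v, ℓ v)
  have key_injective : key.Injective := fun u v h => hℓ (congrArg (fun x => (ofLex x).2) h)
  obtain ⟨π, hπ, hπ_unique⟩ := existsUnique_strictMono_comp_equiv key_injective
  have mem_linExts_iff : π ∈ linExts r ↔ f ∈ partitions r ℓ := by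
    have key_lt_iff (u v : V) : key u < key v ↔ π.symm u < π.symm v := by
      simpa using hπ.lt_iff_lt (a := π.symm u) (b := π.symm v)
    simp [linExts, partitions, ← key_lt_iff, key]
  have sorts_iff (τ : Fin (Fintype.card V) ≃ V) :
      (StrictMono fun i => toLex (f (τ i), ℓ (τ i))) ↔ τ = π :=
    ⟨hπ_unique τ, fun h => h ▸ hπ⟩
  simp only [Finset.sum_apply, Set.indicator_apply, Set.mem_ofPred_eq, sorts_iff,
    Finset.sum_ite_eq', mem_linExts_iff]

/-- The graph of `ω`. It allows one to compute `ω` on power series before knowing that they are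
quasisymmetric. -/
noncomputable def omegaGraph : Submodule R (MvPowerSeries ℕ+ R × MvPowerSeries ℕ+ R) :=
  LinearMap.range ((QSym R).subtype.prod ((QSym R).subtype ∘ₗ omega R))

variable {R} in
theorem coe_omega_of_mem_omegaGraph {g : QSym R} {h : MvPowerSeries ℕ+ R}
    (hgh : (g.1, h) ∈ omegaGraph R) : (omega R g).1 = h := by
  obtain ⟨g', hg'⟩ := hgh
  obtain ⟨h₁, h₂⟩ := Prod.mk.inj hg'
  rwa [← Subtype.ext h₁]

theorem fundamentalSeries_mem_omegaGraph (n : ℕ) (S : Finset (Fin (n - 1))) :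
    (fundamentalSeries R n S, fundamentalSeries R n Sᶜ) ∈ omegaGraph R :=
  ⟨F R n S, Prod.ext rfl (congrArg Subtype.val (omega_F R n S))⟩

theorem coloringSeries_strict_weak_mem_omegaGraph {r : V → V → Prop}
    (hr : ∀ v, ¬ Relation.TransGen r v v) :
    (coloringSeries ({f : V → ℕ+ | ∀ u v, r u v → f u < f v}.indicator (1 : (V → ℕ+) → R)),
      coloringSeries ({f : V → ℕ+ | ∀ u v, r u v → f u ≤ f v}.indicator (1 : (V → ℕ+) → R))) ∈
      omegaGraph R := by
  obtain ⟨_, lt_of_rel⟩ := exists_linearOrder_of_acyclic hr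
  have weak : {f : V → ℕ+ | ∀ u v, r u v → f u ≤ f v} = partitions r id := by
    ext f
    refine forall₃_congr fun u v huv => ?_
    simp [Prod.Lex.toLex_lt_toLex, lt_of_rel u v huv, le_iff_lt_or_eq]
  have strict : {f : V → ℕ+ | ∀ u v, r u v → f u < f v} = partitions r OrderDual.toDual := by
    ext f
    refine forall₃_congr fun u v huv => ?_
    simp [Prod.Lex.toLex_lt_toLex, (lt_of_rel u v huv).not_gt]
  rw [weak, strict, coloringSeries_partitions R r Function.injective_id,
    coloringSeries_partitions R r OrderDual.toDual.injective, prod_mk_sum]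
  refine Submodule.sum_mem _ fun π _ => ?_
  rw [descSet_toDual π.injective]
  simpa using fundamentalSeries_mem_omegaGraph R _ (descSet π)ᶜ

end Partitions

section Reversal
variable {R : Type*} [CommRing R]

theorem coeff_M {n : ℕ} (δ : Composition n) (m : ℕ+ →₀ ℕ) :
    MvPowerSeries.coeff m (M R δ).1 = single ⟨n, compSet δ⟩ 1 (code m) := by
  rw [M_eq, coeff_coord_symm]

theorem exists_eq_sum_blocks (m : ℕ+ →₀ ℕ) :
    ∃ (n : ℕ) (δ : Composition n) (i : Fin δ.length ↪o ℕ+),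
      m = ∑ t, single (i t) (δ.blocksFun t) := by
  obtain ⟨i, hi⟩ := (code_eq_compSet_iff (compSet.symm (code m).2) m).2 (by simp)
  exact ⟨_, _, i, hi.symm⟩

theorem code_sum_blocks_rev {n : ℕ} (δ : Composition n) (i : Fin δ.length ↪o ℕ+) :
    code (∑ t, single (i t) (δ.blocksFun t.rev)) = ⟨n, compSet δ.reverse⟩ := by
  have length_reverse : δ.reverse.length = δ.length := List.length_reverse
  have blocksFun_reverse (t : Fin δ.reverse.length) :
      δ.reverse.blocksFun t = δ.blocksFun (t.cast length_reverse).rev := by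
    refine (List.getElem_reverse (l := δ.blocks) t.2).trans ?_
    simp only [Composition.blocksFun, List.get_eq_getElem, Fin.val_rev, Fin.val_cast,
      Composition.length]
    congr 1
    omega
  rw [← code_sum_blocks δ.reverse ((Fin.castOrderIso length_reverse).toOrderEmbedding.trans i),
    ← (finCongr length_reverse).sum_comp]
  simp [blocksFun_reverse]

theorem coeff_rho (g : QSym R) {n : ℕ} (δ : Composition n) (i : Fin δ.length ↪o ℕ+) :
    MvPowerSeries.coeff (∑ t, single (i t) (δ.blocksFun t)) (rho R g).1 =
      MvPowerSeries.coeff (∑ t, single (i t) (δ.blocksFun t.rev)) g.1 := by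
  classical
  suffices (MvPowerSeries.coeff (∑ t, single (i t) (δ.blocksFun t)) ∘ₗ (QSym R).subtype) ∘ₗ
      rho R = MvPowerSeries.coeff (∑ t, single (i t) (δ.blocksFun t.rev)) ∘ₗ (QSym R).subtype from
    LinearMap.congr_fun this g
  refine (basisM R).ext fun ⟨k, ε⟩ => ?_
  have reverse_eq_iff : (⟨k, compSet ε.reverse⟩ : Σ n : ℕ, Finset (Fin (n - 1))) =
      ⟨n, compSet δ⟩ ↔ (⟨k, compSet ε⟩ : Σ n : ℕ, Finset (Fin (n - 1))) =
      ⟨n, compSet δ.reverse⟩ := by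
    simp only [Sigma.mk.injEq]
    refine and_congr_right ?_
    rintro rfl
    simp [← Composition.reverse_inj (c₂ := δ.reverse)]
  simp only [LinearMap.comp_apply, Submodule.subtype_apply, basisM_apply, rho_M, coeff_M,
    code_sum_blocks, code_sum_blocks_rev, single_apply, reverse_eq_iff]

namespace MultiDigraph
variable {V A : Type*} [Fintype V] [Fintype A] (D : MultiDigraph V A)

theorem coeff_quasiBSeries_rev (y z : R) {k : ℕ} (δ : Fin k → ℕ) (i : Fin k ↪o ℕ+) :
    MvPowerSeries.coeff (∑ t, single (i t) (δ t.rev)) (D.quasiBSeries y z) =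
      MvPowerSeries.coeff (∑ t, single (i t) (δ t)) (D.quasiBSeries z y) := by
  have fiber_rev (g : V → Fin k) :
      ∑ v, single (g v).rev 1 = ∑ t, single t (δ t) ↔
        ∑ v, single (g v) 1 = ∑ t, single t (δ t.rev) := by
    rw [← (mapDomain_injective Fin.rev_injective).eq_iff,
      ← Equiv.sum_comp Fin.revPerm fun t => single t (δ t)]
    simp [mapDomain_finsetSum, mapDomain_single]
  rw [coeff_quasiBSeries, coeff_quasiBSeries]
  refine finsum_mem_eq_of_bijOn (Fin.rev ∘ ·) ⟨fun g hg => (fiber_rev g).2 hg,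
    Fin.rev_injective.comp_left.injOn, fun g hg => ⟨Fin.rev ∘ g, ?_, ?_⟩⟩ fun g _ => ?_
  · exact (fiber_rev _).1 (by simpa using hg)
  · simp [funext_iff]
  · simp [asc, des, mul_comm]

theorem rho_quasiB (y z : R) : rho R (D.quasiB y z) = D.quasiB z y := by
  ext m
  obtain ⟨n, δ, i, rfl⟩ := exists_eq_sum_blocks m
  exact (coeff_rho _ δ i).trans (D.coeff_quasiBSeries_rev y z δ.blocksFun i)

end MultiDigraph
end Reversal

section Orientations

/-- The edge `wv` of the first step of a closed walk along `r` is a bridge, and the rest of the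
walk would connect its endpoints without it. -/
theorem not_transGen_self_of_isAcyclic {V : Type*} {G : SimpleGraph V} (hG : G.IsAcyclic)
    {r : V → V → Prop} (hadj : ∀ u v, r u v → G.Adj u v) (hasymm : ∀ u v, r u v → ¬ r v u)
    (w : V) : ¬ Relation.TransGen r w w := by
  intro closed_walk
  obtain ⟨v, hwv, hvw⟩ := Relation.TransGen.head'_iff.1 closed_walk
  have bridge : ¬ (G.deleteEdges {s(w, v)}).Reachable w v :=
    SimpleGraph.isBridge_iff.1 (SimpleGraph.isAcyclic_iff_forall_isBridge.1 hG (hadj w v hwv))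
  have reachable (x : V) (hx : Relation.ReflTransGen r v x) :
      (G.deleteEdges {s(w, v)}).Reachable v x := by
    induction hx with
    | refl => rfl
    | @tail x x' _ hxx' ih =>
      by_cases hedge : s(x, x') = s(w, v)
      · rcases Sym2.eq_iff.1 hedge with ⟨-, rfl⟩ | ⟨rfl, rfl⟩
        · rfl
        · exact absurd hxx' (hasymm _ _ hwv)
      · exact ih.trans
          (SimpleGraph.deleteEdges_adj.2 ⟨hadj x x' hxx', hedge⟩).reachable
  exact bridge (reachable w hvw).symm

namespace MultiDigraph
variable {V A : Type*} (D : MultiDigraph V A)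

/-- The relation on the vertices given by the arcs of a partial reorientation of `D`: the arc `a`
is kept if `s a = 1`, reversed if `s a = -1` and deleted if `s a = 0`. -/
def orient (s : A → SignType) (u v : V) : Prop :=
  ∃ a, (s a = 1 ∧ D.src a = u ∧ D.tgt a = v) ∨ (s a = -1 ∧ D.tgt a = u ∧ D.src a = v)

variable {D} in
theorem forall_orient_iff {s : A → SignType} {q : V → V → Prop} :
    (∀ u v, D.orient s u v → q u v) ↔
      ∀ a, (s a = 1 → q (D.src a) (D.tgt a)) ∧ (s a = -1 → q (D.tgt a) (D.src a)) := by
  simp only [orient]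
  grind

variable {D} in
theorem IsForest.orient_acyclic (hD : D.IsForest) (s : A → SignType) (w : V) :
    ¬ Relation.TransGen (D.orient s) w w := by
  obtain ⟨no_loop, edge_injective, isAcyclic⟩ := hD
  refine not_transGen_self_of_isAcyclic isAcyclic (forall_orient_iff.2 fun a => ?_) ?_ w
  · have adj : D.toSimpleGraph.Adj (D.src a) (D.tgt a) :=
      (SimpleGraph.fromRel_adj _ _ _).2 ⟨no_loop a, .inl ⟨a, rfl, rfl⟩⟩
    exact ⟨fun _ => adj, fun _ => adj.symm⟩
  · rintro u v ⟨a, ha⟩ ⟨b, hb⟩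
    have same_edge : s(D.src a, D.tgt a) = s(D.src b, D.tgt b) := by
      rw [Sym2.eq_iff]
      grind
    obtain rfl : a = b := edge_injective same_edge
    have := no_loop a
    have : (1 : SignType) ≠ -1 := by decide
    grind

variable {R : Type*} [CommRing R]

/-- The factor contributed by an arc of the given sign to the coefficient of a partial
reorientation in the expansion of `y ^ asc f * z ^ des f`. -/
def arcWeight (y z : R) : SignType → R
  | 0 => 1
  | 1 => y - 1
  | -1 => z - 1

variable [Fintype A]

open Classical in
theorem prod_arcs_eq_sum_orient (y z : R) (q : V → V → Prop) :
    ∏ a, (1 + (if q (D.src a) (D.tgt a) then y - 1 else 0) +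
        (if q (D.tgt a) (D.src a) then z - 1 else 0)) =
      ∑ s : A → SignType,
        if ∀ u v, D.orient s u v → q u v then ∏ a, arcWeight y z (s a) else 0 := by
  let allowed (a : A) (σ : SignType) : Prop :=
    (σ = 1 → q (D.src a) (D.tgt a)) ∧ (σ = -1 → q (D.tgt a) (D.src a))
  calc
    _ = ∏ a, ∑ σ, if allowed a σ then arcWeight y z σ else 0 := by
      refine Finset.prod_congr rfl fun a _ => ?_
      rw [add_right_comm, add_assoc]
      simp [allowed, SignType.univ_eq, arcWeight]
    _ = _ := by
      simp only [Finset.prod_univ_sum, Fintype.piFinset_univ, Finset.prod_ite_zero,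
        Finset.mem_univ, true_imp_iff, forall_orient_iff, allowed]

/-- The number of arcs whose two endpoints have the same color. -/
def ties {P : Type*} [DecidableEq P] (f : V → P) : ℕ :=
  (Finset.univ.filter fun a => f (D.src a) = f (D.tgt a)).card

section Products
variable {P : Type*} [LinearOrder P] (f : V → P)

theorem pow_asc_mul_pow_des_mul_pow_ties (y z t : R) :
    y ^ D.asc f * z ^ D.des f * t ^ D.ties f =
      ∏ a, if f (D.src a) < f (D.tgt a) then y
        else if f (D.tgt a) < f (D.src a) then z else t := by
  simp only [asc, des, ties, ← Finset.prod_const, Finset.prod_filter, ← Finset.prod_mul_distrib]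
  refine Finset.prod_congr rfl fun a _ => ?_
  rcases lt_trichotomy (f (D.src a)) (f (D.tgt a)) with h | h | h
  · simp [h, h.ne, h.not_gt]
  · simp [h]
  · simp [h, h.ne', h.not_gt]

theorem asc_add_des_add_ties : D.asc f + D.des f + D.ties f = Fintype.card A := by
  simp only [asc, des, ties, Finset.card_filter, ← Finset.sum_add_distrib, Fintype.card_eq_sum_ones]
  refine Finset.sum_congr rfl fun a _ => ?_
  rcases lt_trichotomy (f (D.src a)) (f (D.tgt a)) with h | h | h
  · simp [h, h.ne, h.not_gt]
  · simp [h]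
  · simp [h, h.ne', h.not_gt]

open Classical in
theorem pow_asc_mul_pow_des_eq_sum_orient (y z : R) :
    y ^ D.asc f * z ^ D.des f = ∑ s : A → SignType,
      if ∀ u v, D.orient s u v → f u < f v then ∏ a, arcWeight y z (s a) else 0 := by
  rw [← D.prod_arcs_eq_sum_orient, ← mul_one (_ * _), ← one_pow (D.ties f),
    pow_asc_mul_pow_des_mul_pow_ties]
  refine Finset.prod_congr rfl fun a _ => ?_
  rcases lt_trichotomy (f (D.src a)) (f (D.tgt a)) with h | h | h
  · simp [h, h.not_gt]
  · simp [h]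
  · simp [h, h.not_gt]

open Classical in
theorem pow_asc_mul_pow_des_mul_pow_ties_eq_sum_orient (y z : R) :
    y ^ D.asc f * z ^ D.des f * (y + z - 1) ^ D.ties f = ∑ s : A → SignType,
      if ∀ u v, D.orient s u v → f u ≤ f v then ∏ a, arcWeight y z (s a) else 0 := by
  rw [← D.prod_arcs_eq_sum_orient, pow_asc_mul_pow_des_mul_pow_ties]
  refine Finset.prod_congr rfl fun a _ => ?_
  rcases lt_trichotomy (f (D.src a)) (f (D.tgt a)) with h | h | h
  · simp [h.le, h.not_ge, h]
  · simp [h, add_sub_assoc]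
  · simp [h.le, h.not_ge, h, h.not_gt]

end Products

variable [Fintype V]

theorem coe_quasiB (y z : R) :
    (D.quasiB y z).1 = coloringSeries fun f => y ^ D.asc f * z ^ D.des f := rfl

theorem coloringSeries_pow_asc_mul_pow_des_mul_pow_ties (y z t : R) [Invertible t] :
    (coloringSeries fun f => y ^ D.asc f * z ^ D.des f * t ^ D.ties f) =
      (t ^ Fintype.card A • D.quasiB (y * ⅟t) (z * ⅟t)).1 := by
  have cancel (x : R) : t * (x * ⅟t) = x := by rw [mul_left_comm, mul_invOf_self, mul_one]
  rw [Submodule.coe_smul, coe_quasiB, ← map_smul]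
  congr 1
  funext f
  calc
    y ^ D.asc f * z ^ D.des f * t ^ D.ties f
      = (t * (y * ⅟t)) ^ D.asc f * (t * (z * ⅟t)) ^ D.des f * t ^ D.ties f := by
        rw [cancel, cancel]
    _ = t ^ (D.asc f + D.des f + D.ties f) * ((y * ⅟t) ^ D.asc f * (z * ⅟t) ^ D.des f) := by ring
    _ = t ^ Fintype.card A * ((y * ⅟t) ^ D.asc f * (z * ⅟t) ^ D.des f) := by
        rw [asc_add_des_add_ties]

theorem omega_quasiB {y z : R}
    (h : ∀ s : A → SignType, ∏ a, arcWeight y z (s a) ≠ 0 →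
      ∀ v, ¬ Relation.TransGen (D.orient s) v v) :
    (omega R (D.quasiB y z)).1 =
      coloringSeries fun f => y ^ D.asc f * z ^ D.des f * (y + z - 1) ^ D.ties f := by
  classical
  have expand (p : (V → ℕ+) → (A → SignType) → Prop) :
      (fun f => ∑ s : A → SignType, if p f s then ∏ a, arcWeight y z (s a) else 0) =
        ∑ s : A → SignType, (∏ a, arcWeight y z (s a)) •
          {f | p f s}.indicator (1 : (V → ℕ+) → R) := by
    ext f
    simp [Set.indicator_apply]
  apply coe_omega_of_mem_omegaGraph
  -- This has to come first, as the expansion of `y ^ asc f * z ^ des f` would destroy its pattern.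
  simp only [pow_asc_mul_pow_des_mul_pow_ties_eq_sum_orient]
  simp only [coe_quasiB, pow_asc_mul_pow_des_eq_sum_orient, expand, map_sum, map_smul]
  rw [prod_mk_sum]
  refine Submodule.sum_mem _ fun s _ => ?_
  by_cases weight_zero : ∏ a, arcWeight y z (s a) = 0
  · simp only [weight_zero, zero_smul]
    exact (omegaGraph R).zero_mem
  · exact Submodule.smul_mem _ _ (coloringSeries_strict_weak_mem_omegaGraph R (h s weight_zero))

theorem omega_quasiB_of_isAcyclic (hD : D.IsAcyclic) (y : R) [Invertible y] :
    omega R (D.quasiB y 1) = rho R (y ^ Fintype.card A • D.quasiB (⅟y) 1) := by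
  have orient_acyclic (s : A → SignType) (hs : ∏ a, arcWeight y 1 (s a) ≠ 0) (v : V) :
      ¬ Relation.TransGen (D.orient s) v v := by
    have not_reversed (a : A) : s a ≠ -1 := fun ha =>
      hs (Finset.prod_eq_zero (Finset.mem_univ a) (by simp [ha, arcWeight]))
    refine fun closed_walk => hD v
      (Relation.TransGen.mono (forall_orient_iff.2 fun a => ?_) v v closed_walk)
    exact ⟨fun _ => ⟨a, rfl, rfl⟩, fun ha => absurd ha (not_reversed a)⟩
  rw [map_smul, rho_quasiB]
  apply Subtype.ext
  rw [D.omega_quasiB orient_acyclic, add_sub_cancel_right,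
    coloringSeries_pow_asc_mul_pow_des_mul_pow_ties, mul_invOf_self, one_mul]

theorem omega_quasiB_of_isForest (hD : D.IsForest) (y z : R) [Invertible (y + z - 1)] :
    omega R (D.quasiB y z) = (y + z - 1) ^ Fintype.card A •
      D.quasiB (y * ⅟(y + z - 1)) (z * ⅟(y + z - 1)) :=
  Subtype.ext <| (D.omega_quasiB fun s _ => hD.orient_acyclic s).trans
    (D.coloringSeries_pow_asc_mul_pow_des_mul_pow_ties y z (y + z - 1))

end MultiDigraph
end Orientations

end QuasiB

/-- The identities hold for all elements `y`, `z` of a commutative ring for which the denominators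
are invertible; for indeterminates `y`, `z`, take for `R` the fraction field of `ℤ[y, z]`. -/
theorem corollary8p12 {V A : Type*} [Fintype V] [Fintype A] (D : QuasiB.MultiDigraph V A)
    {R : Type*} [CommRing R] :
    (D.IsAcyclic → ∀ (y : R) [Invertible y],
      QuasiB.omega R (D.quasiB y 1) =
        QuasiB.rho R (y ^ Fintype.card A • D.quasiB (⅟y) 1)) ∧
    (D.IsForest → ∀ (y z : R) [Invertible (y + z - 1)],
      QuasiB.omega R (D.quasiB y z) =
        (y + z - 1) ^ Fintype.card A •
          D.quasiB (y * ⅟(y + z - 1)) (z * ⅟(y + z - 1))) :=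
  ⟨fun h y _ => D.omega_quasiB_of_isAcyclic h y, fun h y z _ => D.omega_quasiB_of_isForest h y z⟩
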